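/- Let $G$ be a group, let $g : G \to \mathbb{R}/\mathbb{Z}$ be a homomorphism with dense image (so $G$ is infinite), and for $s > 0$ put $X(s) = g^{-1}(-s,s)$, where $(-s,s)$ denotes the image of this interval in $\mathbb{R}/\mathbb{Z}$. Fix $0 < t \le \frac13$ and let $\mathcal{G} = (G, \cdot, X(t))$ be the expansion of $G$ by a unary predicate for $X(t)$. Then every set $X(t/n)$, $n \ge 1$, is $\emptyset$-definable in $\mathcal{G}$. Let $\kappa > 2^{\aleph_0}$ be a cardinal and let $\mathcal{G}^*$ be an elementary extension of $\mathcal{G}$ that is $\kappa$-saturated and strongly $\kappa$-homogeneous. A subset of $\mathcal{G}^*$ is small if its cardinality is less than $\kappa$, a subgroup has bounded index if its index is less than $\kappa$, and a set is type-definable over $A$ if it is an intersection of $A$-definable sets. For a small set $A \subseteq \mathcal{G}^*$ let $\mathcal{G}^{*0}_A$ be the intersection of all $A$-definable subgroups of $\mathcal{G}^*$ of finite index, and let $\mathcal{G}^{*00}_A$ be the intersection of all subgroups of bounded index that are type-definable over $A$ (this is the smallest such subgroup whenever a smallest one exists). Write $X(t/n)$ also for the interpretation in $\mathcal{G}^*$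 of the $\emptyset$-definable set $X(t/n)$, that is, the set defined in $\mathcal{G}^*$ by any parameter-free formula defining $X(t/n)$ in $\mathcal{G}$. Then $$\tilde{\mathcal{G}} = \bigcap_{n \ge 1} X\left(\tfrac{t}{n}\right) \subseteq \mathcal{G}^*$$ is a subgroup of $\mathcal{G}^*$ that is type-definable over $\emptyset$ and has bounded index, and for every small set $A$, $$\tilde{\mathcal{G}} \cap \mathcal{G}^{*0}_A \subsetneq \mathcal{G}^{*0}_A \qquad\text{and}\qquad \mathcal{G}^{*00}_A \subsetneq \mathcal{G}^{*0}_A .$$ -/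

import Mathlib

open FirstOrder Cardinal

universe u v

/-! ### General model theory -/

section ModelTheory

variable (L : FirstOrder.Language)

/-- `M` is `κ`-saturated: over every parameter set `A` of cardinality `< κ`, every set of
formulas in one variable that is finitely satisfiable in `M` is realized in `M`. -/
def IsKappaSaturated {M : Type v} [L.Structure M] (κ : Cardinal.{v}) : Prop :=
  ∀ A : Set M, #A < κ → ∀ p : Set (L[[A]].Formula (Fin 1)),
    (∀ p₀ : Finset (L[[A]].Formula (Fin 1)), (p₀ : Set (L[[A]].Formula (Fin 1))) ⊆ p →
      ∃ x : M, ∀ φ ∈ p₀, φ.Realize (fun _ => x)) →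
    ∃ x : M, ∀ φ ∈ p, φ.Realize (fun _ => x)

/-- `M` is strongly `κ`-homogeneous: every elementary map from a subset of `M` of cardinality
`< κ` into `M` extends to an automorphism of `M`. -/
def IsStronglyKappaHomogeneous {M : Type v} [L.Structure M] (κ : Cardinal.{v}) : Prop :=
  ∀ A : Set M, #A < κ → ∀ f : A → M,
    (∀ φ : L.Formula A, φ.Realize (fun a : A => (a : M)) ↔ φ.Realize f) →
    ∃ σ : M ≃[L] M, ∀ a : A, σ (a : M) = f a

/-- The formula `φ(x)` (without parameters) defines the set `S` in `M`. -/
def FormulaDefines {M : Type*} [L.Structure M] (φ : L.Formula (Fin 1)) (S : Set M) : Prop :=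
  ∀ x : M, x ∈ S ↔ φ.Realize (fun _ => x)

/-- The interpretation in `N` of a `∅`-definable subset `S` of `M`: the set of points of `N`
that satisfy a formula defining `S` in `M`.  For an elementary extension `N` of `M` it does not
depend on the formula (`interpretation_eq`). -/
def interpretation {M : Type*} [L.Structure M] (N : Type*) [L.Structure N] (S : Set M) : Set N :=
  {x | ∃ φ : L.Formula (Fin 1), FormulaDefines L φ S ∧ φ.Realize (fun _ => x)}

theorem interpretation_eq {L : FirstOrder.Language} {M N : Type*} [L.Structure M] [L.Structure N]
    (j : M ↪ₑ[L] N) {S : Set M} (φ : L.Formula (Fin 1)) (hφ : FormulaDefines L φ S) :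
    FormulaDefines L φ (interpretation L N S) := by
  intro x
  refine ⟨?_, fun h => ⟨φ, hφ, h⟩⟩
  rintro ⟨ψ, hψ, hx⟩
  -- the sentence `∀ x, ψ x → φ x` holds in `M`, hence in `N`
  have key : ∀ v : Fin 1 → N, ψ.Realize v → φ.Realize v := by
    let θ : L.Formula (Empty ⊕ Fin 1) :=
      (ψ.relabel (Sum.inr : Fin 1 → Empty ⊕ Fin 1)).imp
        (φ.relabel (Sum.inr : Fin 1 → Empty ⊕ Fin 1))
    have hM : (Language.Formula.iAlls (Fin 1) θ).Realize (default : Empty → M) := by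
      rw [Language.Formula.realize_iAlls]
      intro v
      simp only [θ, Language.Formula.realize_imp, Language.Formula.realize_relabel]
      have hv : (fun _ => v 0) = v := by
        funext i; rw [Subsingleton.elim i 0]
      have h1 := hψ (v 0)
      have h2 := hφ (v 0)
      rw [hv] at h1 h2
      intro h
      exact h2.1 (h1.2 h)
    have hN := (j.map_formula (Language.Formula.iAlls (Fin 1) θ) default).2 hM
    rw [Language.Formula.realize_iAlls] at hN
    intro v hv
    have := hN v
    simp only [θ, Language.Formula.realize_imp, Language.Formula.realize_relabel] at this
    exact this hv
  exact key _ hx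

/-- `S` is type-definable over `A`: it is an intersection of `A`-definable sets. -/
def IsTypeDefinable {M : Type*} [L.Structure M] (A : Set M) (S : Set M) : Prop :=
  ∃ F : Set (Set M), (∀ D ∈ F, A.Definable₁ L D) ∧ S = ⋂₀ F

/-- The connected component over `A`: the intersection of all `A`-definable subgroups of finite
index. -/
def connectedComponentOver {M : Type*} [L.Structure M] [Group M] (A : Set M) : Subgroup M :=
  sInf {H : Subgroup M | A.Definable₁ L (H : Set M) ∧ H.FiniteIndex}

/-- A subgroup has bounded index (relative to the degree of saturation `κ`): fewer than `κ`
cosets. -/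
def HasBoundedIndex {M : Type v} [Group M] (κ : Cardinal.{v}) (H : Subgroup M) : Prop :=
  #(M ⧸ H) < κ

/-- The type-connected component over `A`: the intersection of all subgroups of bounded index
that are type-definable over `A`.  It is the smallest such subgroup as soon as there is a
smallest one (`typeConnectedComponentOver_eq`). -/
def typeConnectedComponentOver {M : Type v} [L.Structure M] [Group M] (κ : Cardinal.{v})
    (A : Set M) : Subgroup M :=
  sInf {H : Subgroup M | IsTypeDefinable L A (H : Set M) ∧ HasBoundedIndex κ H}

theorem typeConnectedComponentOver_eq {L : FirstOrder.Language} {M : Type v} [L.Structure M]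
    [Group M] {κ : Cardinal.{v}} {A : Set M} {H : Subgroup M}
    (h : IsLeast {H : Subgroup M | IsTypeDefinable L A (H : Set M) ∧ HasBoundedIndex κ H} H) :
    typeConnectedComponentOver L κ A = H :=
  h.isGLB.sInf_eq

end ModelTheory

/-! ### Groups with a predicate -/

/-- The function symbols: one binary symbol, the group operation. -/
inductive GroupPredFunctions : ℕ → Type
  | mul : GroupPredFunctions 2

/-- The relation symbols: one unary predicate. -/
inductive GroupPredRelations : ℕ → Type
  | pred : GroupPredRelations 1

/-- The language `{·, P}` of groups with a unary predicate. -/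
def groupPredLanguage : FirstOrder.Language :=
  ⟨GroupPredFunctions, GroupPredRelations⟩

/-- The structure `(G, ·, P)`: the group `G` expanded by the predicate `P`. -/
def WithPred (G : Type*) (_P : Set G) : Type _ := G

namespace WithPred

variable {G : Type*} {P : Set G}

instance [Group G] : Group (WithPred G P) := inferInstanceAs (Group G)

instance [Group G] : groupPredLanguage.Structure (WithPred G P) where
  funMap := fun {_} f =>
    match f with
    | GroupPredFunctions.mul => fun x => x 0 * x 1
  RelMap := fun {_} r =>
    match r with
    | GroupPredRelations.pred => fun x => (show G from x 0) ∈ P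

end WithPred

/-- `X(t) = g⁻¹(-t, t)`, for a homomorphism `g` from `G` to the circle `ℝ/ℤ`: the elements whose
image is the class of a real number in the open interval `(-t, t)`. -/
def arcPreimage {G : Type*} [Group G] (g : G →* Multiplicative UnitAddCircle) (t : ℝ) : Set G :=
  {x | ∃ r ∈ Set.Ioo (-t) t, ((r : ℝ) : UnitAddCircle) = (g x).toAdd}

/-! Since `t ≤ 1 / 3`, `X(t/n)` consists of the `x` with `x, x ^ 2, …, x ^ n` in `X(t)`
(`arcPreimage_div`). This is first-order in the predicate, so the intersection of the `X(t/n)` in an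
elementary extension is the set of elements all of whose positive powers satisfy the predicate.

Two facts about arcs transfer to the extension. The triangle inequality, in the form `X(t/2n)⁻¹
X(t/2n) ⊆ X(t/n)`, makes the intersection a subgroup. By density and compactness, finitely many
translates of `X(t/n)` by elements of `G` cover; recording for each `n` a translate containing a
given element determines its coset, so there are at most `2 ^ ℵ₀` cosets.

For strictness, a subgroup of finite index contains all `m`-th powers for some `m ≠ 0`, while some
`m`-th power in `G` avoids `X(t)`; hence no such subgroup lies inside the predicate
(`not_subset_of_finiteIndex`). Saturation then yields a point of the connected component outside the
predicate, hence outside the intersection and the smaller type-connected component. -/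

/-! ### Arcs of the circle -/

/-- The image of the interval `(-t, t)` in the circle `ℝ/ℤ`. -/
def circleArc (t : ℝ) : Set UnitAddCircle :=
  (fun r : ℝ => (r : UnitAddCircle)) '' Set.Ioo (-t) t

theorem isOpen_circleArc (t : ℝ) : IsOpen (circleArc t) :=
  QuotientAddGroup.isOpenMap_coe _ isOpen_Ioo

theorem zero_mem_circleArc {t : ℝ} (ht : 0 < t) : (0 : UnitAddCircle) ∈ circleArc t :=
  ⟨0, ⟨by linarith, ht⟩, rfl⟩

theorem exists_int_of_unitAddCircle_coe_eq {r s : ℝ}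
    (h : (r : UnitAddCircle) = (s : UnitAddCircle)) : ∃ z : ℤ, r - s = z := by
  have h0 : ((r - s : ℝ) : UnitAddCircle) = 0 := by
    rw [AddCircle.coe_sub, h, sub_self]
  obtain ⟨z, hz⟩ := (AddCircle.coe_eq_zero_iff (p := (1 : ℝ))).1 h0
  exact ⟨z, by simpa using hz.symm⟩

theorem nsmul_mem_circleArc {t : ℝ} {n k : ℕ} (hk : k ≤ n) (hn : 1 ≤ n) (ht : 0 < t)
    {a : UnitAddCircle} (ha : a ∈ circleArc (t / n)) : k • a ∈ circleArc t := by
  obtain ⟨r, hr, rfl⟩ := ha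
  have hn' : (0 : ℝ) < n := by exact_mod_cast hn
  have hk' : (k : ℝ) ≤ n := by exact_mod_cast hk
  have hr' : |r| < t / n := abs_lt.2 hr
  refine ⟨k • r, abs_lt.1 ?_, by simp⟩
  rw [nsmul_eq_mul, abs_mul, Nat.abs_cast]
  calc (k : ℝ) * |r| ≤ n * |r| := by gcongr
    _ < n * (t / n) := by gcongr
    _ = t := by field_simp

/-- In the induction step a representative with `|r| < t / n` has `|(n + 1) r| < 2t`. It differs
from some `s` with `|s| < t` by an integer of absolute value below `3t ≤ 1`, hence by zero, so `(n +
1) |r| < t`. -/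
theorem mem_circleArc_div_of_nsmul_mem {t : ℝ} (ht : t ≤ 1 / 3) {n : ℕ} (hn : 1 ≤ n)
    {a : UnitAddCircle} (ha : ∀ k, 1 ≤ k → k ≤ n → k • a ∈ circleArc t) :
    a ∈ circleArc (t / n) := by
  induction n, hn using Nat.le_induction with
  | base => simpa using ha 1 le_rfl le_rfl
  | succ n hn ih =>
    obtain ⟨r, hr, rfl⟩ := ih fun k h1 h2 => ha k h1 (by omega)
    obtain ⟨s, hs, hsr⟩ := ha (n + 1) (by omega) le_rfl
    have hn' : (1 : ℝ) ≤ n := by exact_mod_cast hn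
    have ht0 : 0 < t := by linarith [hs.1, hs.2]
    obtain ⟨z, hz⟩ := exists_int_of_unitAddCircle_coe_eq
      (r := ((n + 1 : ℕ) : ℝ) * r) (s := s) (by
        rw [← nsmul_eq_mul, AddCircle.coe_nsmul]; exact hsr.symm)
    have hr' : |r| < t / n := abs_lt.2 hr
    have hnr : |((n + 1 : ℕ) : ℝ) * r| < 2 * t := by
      rw [abs_mul, Nat.abs_cast]
      calc ((n + 1 : ℕ) : ℝ) * |r| < ((n + 1 : ℕ) : ℝ) * (t / n) := by gcongr
        _ ≤ (2 * n) * (t / n) := by gcongr; push_cast; linarith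
        _ = 2 * t := by field_simp
    have hz0 : z = 0 := by
      rw [abs_lt] at hnr
      have h1 : (z : ℝ) < 1 := by linarith [hs.1, hnr.2]
      have h2 : (-1 : ℝ) < z := by linarith [hs.2, hnr.1]
      have h3 : z < 1 := by exact_mod_cast h1
      have h4 : -1 < z := by exact_mod_cast h2
      omega
    rw [hz0, Int.cast_zero, sub_eq_zero] at hz
    have hpos : (0 : ℝ) < ((n + 1 : ℕ) : ℝ) := by positivity
    refine ⟨r, abs_lt.1 ?_, rfl⟩
    rw [lt_div_iff₀ hpos, ← abs_of_pos hpos, ← abs_mul, mul_comm, hz]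
    exact abs_lt.2 hs

theorem mem_arcPreimage_iff {G : Type*} [Group G] {g : G →* Multiplicative UnitAddCircle}
    {t : ℝ} {x : G} : x ∈ arcPreimage g t ↔ (g x).toAdd ∈ circleArc t :=
  Iff.rfl

theorem sub_mem_circleArc {t : ℝ} {a b : UnitAddCircle} (ha : a ∈ circleArc (t / 2))
    (hb : b ∈ circleArc (t / 2)) : b - a ∈ circleArc t := by
  obtain ⟨r, hr, rfl⟩ := ha
  obtain ⟨s, hs, rfl⟩ := hb
  exact ⟨s - r, ⟨by linarith [hr.2, hs.1], by linarith [hr.1, hs.2]⟩, by simp⟩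

/-! ### Elements with powers in a given set -/

/-- The elements `x` all of whose powers `x, x ^ 2, …, x ^ n` lie in `P`. -/
def powersIn {G : Type*} [Group G] (P : Set G) (n : ℕ) : Set G :=
  {x | ∀ k, 1 ≤ k → k ≤ n → x ^ k ∈ P}

theorem arcPreimage_div {G : Type*} [Group G] (g : G →* Multiplicative UnitAddCircle)
    {t : ℝ} (ht0 : 0 < t) (ht : t ≤ 1 / 3) {n : ℕ} (hn : 1 ≤ n) :
    arcPreimage g (t / n) = powersIn (arcPreimage g t) n := by
  ext x
  simp only [powersIn, Set.mem_ofPred_eq, mem_arcPreimage_iff, map_pow, toAdd_pow]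
  exact ⟨fun h k _ hk => nsmul_mem_circleArc hk hn ht0 h, mem_circleArc_div_of_nsmul_mem ht hn⟩

/-- The triangle inequality for arcs, phrased through powers so that it becomes a first-order
sentence about the predicate. -/
theorem mem_powersIn_of_mul_mem {G : Type*} [Group G] (g : G →* Multiplicative UnitAddCircle)
    {t : ℝ} (ht0 : 0 < t) (ht : t ≤ 1 / 3) {n : ℕ} (hn : 1 ≤ n) {a c : G}
    (ha : a ∈ powersIn (arcPreimage g t) (n * 2))
    (hac : a * c ∈ powersIn (arcPreimage g t) (n * 2)) :
    c ∈ powersIn (arcPreimage g t) n := by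
  rw [← arcPreimage_div g ht0 ht (by omega), mem_arcPreimage_iff] at *
  push_cast at ha hac
  rw [← div_div] at ha hac
  simpa using sub_mem_circleArc ha hac

theorem exists_finset_mul_mem_arcPreimage {G : Type*} [Group G]
    (g : G →* Multiplicative UnitAddCircle) (hg : DenseRange g) {s : ℝ} (hs : 0 < s) :
    ∃ F : Finset G, ∀ y : G, ∃ f ∈ F, f * y ∈ arcPreimage g s := by
  have hopen (f : G) : IsOpen {c : UnitAddCircle | (g f).toAdd + c ∈ circleArc s} :=
    (isOpen_circleArc s).preimage (continuous_const.add continuous_id)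
  obtain ⟨F, hF⟩ := isCompact_univ.elim_finite_subcover _ hopen fun c _ => by
    have hV : IsOpen {d : UnitAddCircle | d + c ∈ circleArc s} :=
      (isOpen_circleArc s).preimage (continuous_id.add continuous_const)
    obtain ⟨f, hf⟩ := DenseRange.exists_mem_open (f := fun x => (g x).toAdd) hg hV
      ⟨-c, by simpa using zero_mem_circleArc hs⟩
    exact Set.mem_iUnion.2 ⟨f, hf⟩
  refine ⟨F, fun y => ?_⟩
  obtain ⟨f, hf, h⟩ := Set.mem_iUnion₂.1 (hF (Set.mem_univ (g y).toAdd))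
  exact ⟨f, hf, by simpa [mem_arcPreimage_iff] using h⟩

theorem exists_pow_notMem_arcPreimage {G : Type*} [Group G]
    (g : G →* Multiplicative UnitAddCircle) (hg : DenseRange g) {t : ℝ} (ht : t ≤ 1 / 3)
    {m : ℕ} (hm : m ≠ 0) : ∃ x : G, x ^ m ∉ arcPreimage g t := by
  -- The arc `(t, 1 - t)` is disjoint from `(-t, t)` and contains `1/2`; its preimage under
  -- multiplication by `m` is open and contains `1/(2m)`, so density applies.
  have hV : IsOpen {c : UnitAddCircle |
      m • c ∈ (fun r : ℝ => (r : UnitAddCircle)) '' Set.Ioo t (1 - t)} :=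
    (QuotientAddGroup.isOpenMap_coe _ isOpen_Ioo).preimage (continuous_id.nsmul m)
  have hm' : (m : ℝ) ≠ 0 := by exact_mod_cast hm
  obtain ⟨x, r, hr, hrx⟩ := DenseRange.exists_mem_open (f := fun x => (g x).toAdd) hg hV
    ⟨((1 / (2 * m) : ℝ) : UnitAddCircle), 1 / 2, ⟨by linarith, by linarith⟩, by
      simp only [← AddCircle.coe_nsmul, nsmul_eq_mul]
      congr 1
      field_simp⟩
  refine ⟨x, ?_⟩
  rintro ⟨s, hs, hsx⟩
  rw [map_pow, toAdd_pow, ← hrx] at hsx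
  obtain ⟨z, hz⟩ := exists_int_of_unitAddCircle_coe_eq hsx.symm
  have h1 : (0 : ℝ) < z := by linarith [hs.2, hr.1]
  have h2 : (z : ℝ) < 1 := by linarith [hs.1, hr.2]
  have h3 : 0 < z := by exact_mod_cast h1
  have h4 : z < 1 := by exact_mod_cast h2
  omega

/-! ### Formulas in the language of groups with a predicate -/

theorem realize_forall_iff_of_elementaryEmbedding {L : FirstOrder.Language} {M N : Type*}
    [L.Structure M] [L.Structure N] (j : M ↪ₑ[L] N) {α γ : Type*} [Finite γ] (v : α → M)
    (φ : L.Formula (α ⊕ γ)) :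
    (∀ w : γ → N, φ.Realize (Sum.elim (j ∘ v) w)) ↔ ∀ w : γ → M, φ.Realize (Sum.elim v w) := by
  have := j.map_formula (Language.Formula.iAlls γ φ) v
  simpa only [Language.Formula.realize_iAlls] using this

namespace WithPred

/-- The term `s · t`. -/
def mulTerm {α : Type*} (s t : groupPredLanguage.Term α) : groupPredLanguage.Term α :=
  Language.Functions.apply₂ (L := groupPredLanguage) GroupPredFunctions.mul s t

/-- The term `t ^ (k + 1)`. -/
def powSuccTerm {α : Type*} (t : groupPredLanguage.Term α) : ℕ → groupPredLanguage.Term α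
  -- The language has no symbol for the identity, so exponents start at one.
  | 0 => t
  | k + 1 => mulTerm (powSuccTerm t k) t

/-- The formula saying that `t` satisfies the predicate. -/
def predFormula {α : Type*} (t : groupPredLanguage.Term α) : groupPredLanguage.Formula α :=
  Language.Relations.formula₁ (L := groupPredLanguage) GroupPredRelations.pred t

/-- The formula saying that `t, t ^ 2, …, t ^ n` satisfy the predicate. -/
def powersFormula {α : Type*} (t : groupPredLanguage.Term α) : ℕ → groupPredLanguage.Formula α
  | 0 => ⊤
  | n + 1 => powersFormula t n ⊓ predFormula (powSuccTerm t n)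

variable {G : Type*} [Group G] {P : Set G} {α : Type*} (v : α → WithPred G P)

@[simp]
theorem realize_mulTerm (s t : groupPredLanguage.Term α) :
    (mulTerm s t).realize v = s.realize v * t.realize v :=
  Language.Term.realize_functions_apply₂ (L := groupPredLanguage)

@[simp]
theorem realize_powSuccTerm (t : groupPredLanguage.Term α) (k : ℕ) :
    (powSuccTerm t k).realize v = t.realize v ^ (k + 1) := by
  induction k with
  | zero => simp [powSuccTerm]
  | succ k ih => rw [powSuccTerm, realize_mulTerm, ih, pow_succ _ (k + 1)]

@[simp]
theorem realize_predFormula (t : groupPredLanguage.Term α) :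
    (predFormula t).Realize v ↔ t.realize v ∈ (P : Set (WithPred G P)) :=
  Language.Formula.realize_rel₁ (L := groupPredLanguage)

@[simp]
theorem realize_powersFormula (t : groupPredLanguage.Term α) (n : ℕ) :
    (powersFormula t n).Realize v ↔ t.realize v ∈ powersIn (G := WithPred G P) P n := by
  induction n with
  | zero => exact iff_of_true (by simp [powersFormula]) fun k h1 h2 => by omega
  | succ n ih =>
    rw [powersFormula, Language.Formula.realize_inf, ih, realize_predFormula, realize_powSuccTerm]
    constructor
    · rintro ⟨h, h'⟩ k h1 h2
      obtain h2 | rfl := Nat.lt_or_eq_of_le h2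
      · exact h k h1 (by omega)
      · exact h'
    · exact fun h => ⟨fun k h1 h2 => h k h1 (by omega), h _ (by omega) le_rfl⟩

theorem formulaDefines_pred :
    FormulaDefines groupPredLanguage (M := WithPred G P)
      (predFormula (Language.Term.var (0 : Fin 1))) P := fun x =>
  (realize_predFormula (P := P) (fun _ => x) (Language.Term.var (0 : Fin 1))).symm

theorem formulaDefines_powersIn (n : ℕ) :
    FormulaDefines groupPredLanguage (powersFormula (Language.Term.var (0 : Fin 1)) n)
      (powersIn (G := WithPred G P) P n) := fun x => by
  simp

end WithPred

theorem FormulaDefines.definable₁ {L : FirstOrder.Language} {M : Type*} [L.Structure M]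
    {φ : L.Formula (Fin 1)} {S : Set M} (h : FormulaDefines L φ S) (A : Set M) :
    A.Definable₁ L S := by
  refine Set.Definable.mono (A := ∅) (Set.empty_definable_iff.2 ⟨φ, ?_⟩) (Set.empty_subset A)
  ext x
  have hx : (fun _ => x 0) = x := funext fun i => by rw [Subsingleton.elim i 0]
  simpa [hx] using h (x 0)

theorem FormulaDefines.ext {L : FirstOrder.Language} {M : Type*} [L.Structure M]
    {φ : L.Formula (Fin 1)} {S T : Set M} (h : FormulaDefines L φ S) (h' : FormulaDefines L φ T) :
    S = T :=
  Set.ext fun x => (h x).trans (h' x).symm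

theorem definable₁_of_eq_powersIn {G : Type*} [Group G] {P : Set G} {S : Set (WithPred G P)}
    {n : ℕ} (hS : S = powersIn (G := WithPred G P) P n) (A : Set (WithPred G P)) :
    A.Definable₁ groupPredLanguage S :=
  hS ▸ (WithPred.formulaDefines_powersIn n).definable₁ A

theorem interpretation_of_eq_powersIn {G : Type*} [Group G] {P : Set G} {N : Type*} [Group N]
    {Q : Set N} (j : WithPred G P ↪ₑ[groupPredLanguage] WithPred N Q) {S : Set (WithPred G P)}
    {n : ℕ} (hS : S = powersIn (G := WithPred G P) P n) :
    interpretation groupPredLanguage (WithPred N Q) S = powersIn (G := WithPred N Q) Q n :=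
  hS ▸ (interpretation_eq j _ (WithPred.formulaDefines_powersIn n)).ext
    (WithPred.formulaDefines_powersIn n)

/-! ### Subgroups of finite index -/

/-- The index is an exponent for the quotient only for a normal subgroup, hence the passage to the
normal core. -/
theorem Subgroup.exists_pow_mem_of_finiteIndex {G : Type*} [Group G] (D : Subgroup G)
    [D.FiniteIndex] : ∃ m : ℕ, m ≠ 0 ∧ ∀ x : G, x ^ m ∈ D :=
  ⟨D.normalCore.index, Subgroup.FiniteIndex.index_ne_zero,
    fun x => D.normalCore_le (Subgroup.pow_index_mem _ x)⟩

/-- In a `κ`-saturated group, a definable set that contains no definable subgroup of finite index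
does not contain the connected component. -/
theorem exists_mem_connectedComponentOver_notMem {L : FirstOrder.Language} {M : Type v}
    [L.Structure M] [Group M] {κ : Cardinal.{v}} (hsat : IsKappaSaturated L (M := M) κ)
    {A : Set M} (hA : #A < κ) {S : Set M} (hS : A.Definable₁ L S)
    (hD : ∀ D : Subgroup M, D.FiniteIndex → ¬ (D : Set M) ⊆ S) :
    ∃ x ∈ connectedComponentOver L A, x ∉ S := by
  obtain ⟨σ, hσ⟩ := hS
  have hσ' (x : M) : x ∈ S ↔ σ.Realize (fun _ => x) :=
    Set.ext_iff.1 hσ fun _ => x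
  -- The formulas implied by "in `D`, outside `S`" for some finite-index `D`. Finitely many of them
  -- hold at any point outside `S` of the intersection of the corresponding subgroups.
  let p : Set (L[[A]].Formula (Fin 1)) :=
    {φ | ∃ D : Subgroup M, D.FiniteIndex ∧ ∀ x : M, x ∈ D → x ∉ S → φ.Realize (fun _ => x)}
  obtain ⟨x, hx⟩ := hsat A hA p fun p₀ hp₀ => by
    have hp (φ : p₀) : ∃ D : Subgroup M, D.FiniteIndex ∧
        ∀ x : M, x ∈ D → x ∉ S → φ.1.Realize (fun _ => x) := hp₀ φ.2
    choose D hDfin hDx using hp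
    have hfin : (⨅ φ, D φ).FiniteIndex :=
      Subgroup.finiteIndex_iInf hDfin
    obtain ⟨x, hxD, hxS⟩ := Set.not_subset.1 (hD _ hfin)
    exact ⟨x, fun φ hφ => hDx ⟨φ, hφ⟩ x (Subgroup.mem_iInf.1 hxD _) hxS⟩
  refine ⟨x, ?_, fun hxS => ?_⟩
  · refine Subgroup.mem_sInf.2 ?_
    rintro D ⟨⟨φ, hφ⟩, hDfin⟩
    have hφ' (y : M) : y ∈ D ↔ φ.Realize (fun _ => y) := Set.ext_iff.1 hφ fun _ => y
    exact (hφ' x).2 (hx φ ⟨D, hDfin, fun y hy _ => (hφ' y).1 hy⟩)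
  · have := hx σ.not ⟨⊤, inferInstance, fun y _ hy =>
      Language.Formula.realize_not.2 fun h => hy ((hσ' y).2 h)⟩
    exact Language.Formula.realize_not.1 this ((hσ' x).1 hxS)

theorem typeConnectedComponentOver_le_connectedComponentOver {L : FirstOrder.Language}
    {M : Type v} [L.Structure M] [Group M] {κ : Cardinal.{v}} (hκ : ℵ₀ ≤ κ) (A : Set M) :
    typeConnectedComponentOver L κ A ≤ connectedComponentOver L A := by
  refine sInf_le_sInf ?_
  rintro D ⟨hD, hfin⟩
  exact ⟨⟨{(D : Set M)}, by simpa using hD, by simp⟩, (Cardinal.lt_aleph0_of_finite _).trans_le hκ⟩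

theorem IsTypeDefinable.mono {L : FirstOrder.Language} {M : Type*} [L.Structure M]
    {A B S : Set M} (h : IsTypeDefinable L A S) (hAB : A ⊆ B) : IsTypeDefinable L B S := by
  obtain ⟨F, hF, rfl⟩ := h
  exact ⟨F, fun D hD => (hF D hD).mono hAB, rfl⟩

/-- A subgroup that is a countable intersection of sets `U n`, for which countably many translates
of suitable sets `V n` with `(V n)⁻¹ * V n ⊆ U n` cover the group, has at most `2 ^ ℵ₀` cosets. -/
theorem Subgroup.mk_quotient_le_two_power_aleph0 {M : Type v} [Group M] (H : Subgroup M)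
    {U V : ℕ → Set M} (hU : ∀ x, (∀ n, x ∈ U n) → x ∈ H)
    (hV : ∀ n a c, a ∈ V n → a * c ∈ V n → c ∈ U n)
    (hcov : ∀ n, ∃ f : ℕ → M, ∀ y, ∃ i, f i * y ∈ V n) : #(M ⧸ H) ≤ 2 ^ ℵ₀ := by
  choose f i hi using hcov
  have hinj : Function.Injective fun (q : M ⧸ H) (n : ℕ) => i n q.out := fun q r hqr => by
    rw [← QuotientGroup.out_eq' q, ← QuotientGroup.out_eq' r, QuotientGroup.eq]
    -- With a common translate `f`, take `a = f * q.out` and `c = q.out⁻¹ * r.out`, so that `a * c =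
    -- f * r.out`.
    refine hU _ fun n => hV n _ _ (hi n q.out) ?_
    have hn : i n q.out = i n r.out := congrFun hqr n
    simpa [hn, mul_assoc] using hi n r.out
  simpa using Cardinal.mk_le_of_injective (Equiv.ulift.{v}.symm.injective.comp hinj)

/-! ### Elementary extensions of `(G, ·, X(t))` -/

section ElementaryExtension

variable {G : Type u} [Group G] {g : G →* Multiplicative UnitAddCircle} {t : ℝ}
  {N : Type v} [Group N] {Q : Set N}

theorem mem_powersIn_of_mul_mem_of_elementaryEmbedding
    (j : WithPred G (arcPreimage g t) ↪ₑ[groupPredLanguage] WithPred N Q)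
    (ht0 : 0 < t) (ht : t ≤ 1 / 3) {n : ℕ} (hn : 1 ≤ n) {a c : WithPred N Q}
    (ha : a ∈ powersIn (G := WithPred N Q) Q (n * 2))
    (hac : a * c ∈ powersIn (G := WithPred N Q) Q (n * 2)) :
    c ∈ powersIn (G := WithPred N Q) Q n := by
  let x : groupPredLanguage.Term (Empty ⊕ Fin 2) := Language.Term.var (Sum.inr 0)
  let y : groupPredLanguage.Term (Empty ⊕ Fin 2) := Language.Term.var (Sum.inr 1)
  have key := (realize_forall_iff_of_elementaryEmbedding j Empty.elim
    ((WithPred.powersFormula x (n * 2)).imp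
      ((WithPred.powersFormula (WithPred.mulTerm x y) (n * 2)).imp
        (WithPred.powersFormula y n)))).2 fun w => by
      simp only [Language.Formula.realize_imp, WithPred.realize_powersFormula,
        WithPred.realize_mulTerm]
      exact mem_powersIn_of_mul_mem g ht0 ht hn
  simp only [Language.Formula.realize_imp, WithPred.realize_powersFormula,
    WithPred.realize_mulTerm] at key
  exact key ![a, c] ha hac

theorem exists_seq_mul_mem_powersIn (hg : DenseRange g)
    (j : WithPred G (arcPreimage g t) ↪ₑ[groupPredLanguage] WithPred N Q)
    (ht0 : 0 < t) (ht : t ≤ 1 / 3) {n : ℕ} (hn : 1 ≤ n) :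
    ∃ f : ℕ → WithPred N Q, ∀ y, ∃ i, f i * y ∈ powersIn (G := WithPred N Q) Q n := by
  have hn' : (0 : ℝ) < n := by exact_mod_cast hn
  obtain ⟨F, hF⟩ := exists_finset_mul_mem_arcPreimage g hg (div_pos ht0 hn')
  rw [arcPreimage_div g ht0 ht hn] at hF
  have key := (realize_forall_iff_of_elementaryEmbedding j (fun f : F => (f : G))
    (Language.Formula.iSup fun f : F => WithPred.powersFormula
      (WithPred.mulTerm (Language.Term.var (Sum.inl f)) (Language.Term.var (Sum.inr (0 : Fin 1))))
      n)).2 fun w => by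
      simp only [Language.Formula.realize_iSup, WithPred.realize_powersFormula,
        WithPred.realize_mulTerm]
      obtain ⟨f, hf, h⟩ := hF (w 0)
      exact ⟨⟨f, hf⟩, h⟩
  simp only [Language.Formula.realize_iSup, WithPred.realize_powersFormula,
    WithPred.realize_mulTerm] at key
  -- Some translate meets the identity, so `F` is nonempty and `ℕ` can enumerate it; one index type
  -- then serves every `n`.
  obtain ⟨f₀, hf₀, -⟩ := hF 1
  have : Nonempty F := ⟨⟨f₀, hf₀⟩⟩
  obtain ⟨e, he⟩ := exists_surjective_nat F
  refine ⟨fun i => j (e i : G), fun y => ?_⟩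
  obtain ⟨f, hf⟩ := key fun _ => y
  obtain ⟨i, rfl⟩ := he f
  exact ⟨i, hf⟩

/-- Otherwise "every `m`-th power satisfies the predicate" would hold in the extension, hence in
`G`. The subgroup itself need not be definable. -/
theorem not_subset_of_finiteIndex (hg : DenseRange g)
    (j : WithPred G (arcPreimage g t) ↪ₑ[groupPredLanguage] WithPred N Q) (ht : t ≤ 1 / 3)
    (D : Subgroup (WithPred N Q)) (hD : D.FiniteIndex) : ¬ (D : Set (WithPred N Q)) ⊆ Q := by
  intro hDQ
  obtain ⟨m, hm, hmD⟩ := D.exists_pow_mem_of_finiteIndex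
  obtain ⟨k, rfl⟩ := Nat.exists_eq_succ_of_ne_zero hm
  obtain ⟨x, hx⟩ := exists_pow_notMem_arcPreimage g hg ht hm
  have key := (realize_forall_iff_of_elementaryEmbedding j Empty.elim
    (WithPred.predFormula
      (WithPred.powSuccTerm (Language.Term.var (Sum.inr (0 : Fin 1))) k))).1 fun w => by
      rw [WithPred.realize_predFormula, WithPred.realize_powSuccTerm]
      exact hDQ (hmD _)
  simp only [WithPred.realize_predFormula, WithPred.realize_powSuccTerm] at key
  exact hx (key fun _ => x)

/-- The subgroup of the elements of an elementary extension of `(G, ·, X(t))` all of whose positive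
powers satisfy the predicate. -/
def infinitesimalSubgroup (hg : DenseRange g)
    (j : WithPred G (arcPreimage g t) ↪ₑ[groupPredLanguage] WithPred N Q)
    (ht0 : 0 < t) (ht : t ≤ 1 / 3) : Subgroup (WithPred N Q) :=
  -- A translate covering `1` provides some `a` in the set for `n * 2`; then `a * 1 = a` gives the
  -- claim.
  have one_mem : ∀ n, 1 ≤ n → (1 : WithPred N Q) ∈ powersIn (G := WithPred N Q) Q n :=
    fun n hn => by
      obtain ⟨f, hf⟩ := exists_seq_mul_mem_powersIn hg j ht0 ht (n := n * 2) (by omega)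
      obtain ⟨i, hi⟩ := hf 1
      exact mem_powersIn_of_mul_mem_of_elementaryEmbedding j ht0 ht hn (by simpa using hi) hi
  have inv_mem : ∀ x : WithPred N Q, (∀ n, 1 ≤ n → x ∈ powersIn (G := WithPred N Q) Q n) →
      ∀ n, 1 ≤ n → x⁻¹ ∈ powersIn (G := WithPred N Q) Q n := fun x hx n hn =>
    mem_powersIn_of_mul_mem_of_elementaryEmbedding j ht0 ht hn (hx _ (by omega))
      (by simpa using one_mem _ (by omega))
  { carrier := ⋂ (n : ℕ) (_ : 1 ≤ n), powersIn (G := WithPred N Q) Q n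
    one_mem' := Set.mem_iInter₂.2 one_mem
    inv_mem' := fun {x} hx => by
      rw [Set.mem_iInter₂] at hx ⊢
      exact inv_mem x hx
    mul_mem' := fun {x y} hx hy => by
      rw [Set.mem_iInter₂] at hx hy ⊢
      -- Here `a = x⁻¹` and `c = x * y`, so `a * c = y`.
      exact fun n hn => mem_powersIn_of_mul_mem_of_elementaryEmbedding j ht0 ht hn
        (inv_mem x hx (n * 2) (by omega)) (by simpa using hy (n * 2) (by omega)) }

variable (hg : DenseRange g)
  (j : WithPred G (arcPreimage g t) ↪ₑ[groupPredLanguage] WithPred N Q)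
  (ht0 : 0 < t) (ht : t ≤ 1 / 3)

theorem coe_infinitesimalSubgroup :
    (infinitesimalSubgroup hg j ht0 ht : Set (WithPred N Q)) =
      ⋂ (n : ℕ) (_ : 1 ≤ n), powersIn (G := WithPred N Q) Q n :=
  rfl

theorem infinitesimalSubgroup_subset :
    (infinitesimalSubgroup hg j ht0 ht : Set (WithPred N Q)) ⊆ Q := fun x hx => by
  simpa using Set.mem_iInter₂.1 hx 1 le_rfl 1 le_rfl le_rfl

theorem isTypeDefinable_infinitesimalSubgroup :
    IsTypeDefinable groupPredLanguage ∅
      (infinitesimalSubgroup hg j ht0 ht : Set (WithPred N Q)) := by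
  refine ⟨{S | ∃ n, 1 ≤ n ∧ S = powersIn (G := WithPred N Q) Q n}, ?_, ?_⟩
  · rintro _ ⟨n, -, rfl⟩
    exact definable₁_of_eq_powersIn rfl ∅
  · rw [coe_infinitesimalSubgroup]
    ext x
    simp only [Set.mem_iInter, Set.mem_sInter, Set.mem_ofPred_eq]
    exact ⟨by rintro h _ ⟨n, hn, rfl⟩; exact h n hn, fun h n hn => h _ ⟨n, hn, rfl⟩⟩

theorem mk_quotient_infinitesimalSubgroup_le :
    #(WithPred N Q ⧸ infinitesimalSubgroup hg j ht0 ht) ≤ 2 ^ ℵ₀ :=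
  Subgroup.mk_quotient_le_two_power_aleph0 _
    (U := fun n => powersIn (G := WithPred N Q) Q (n + 1))
    (V := fun n => powersIn (G := WithPred N Q) Q ((n + 1) * 2))
    (fun x hx => Set.mem_iInter₂.2 fun n hn => by
      obtain ⟨k, rfl⟩ := Nat.exists_eq_add_of_le' hn
      exact hx k)
    (fun n _ _ => mem_powersIn_of_mul_mem_of_elementaryEmbedding j ht0 ht (by omega))
    fun n => exists_seq_mul_mem_powersIn hg j ht0 ht (by omega)

end ElementaryExtension

theorem proposition4p3 {G : Type u} [Group G] (g : G →* Multiplicative UnitAddCircle)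
    (hg : DenseRange g) (t : ℝ) (ht0 : 0 < t) (ht : t ≤ 1 / 3) :
    -- each `X(t/n)` is `∅`-definable in `𝓖 = (G, ·, X(t))`
    (∀ n : ℕ, 1 ≤ n →
      (∅ : Set (WithPred G (arcPreimage g t))).Definable₁ groupPredLanguage
        (arcPreimage g (t / n))) ∧
    -- for every sufficiently saturated elementary extension `𝓖* = (N, ·, Q)` of `𝓖`
    ∀ (N : Type v) [Group N] (Q : Set N)
      (_ : WithPred G (arcPreimage g t) ↪ₑ[groupPredLanguage] WithPred N Q)
      (κ : Cardinal.{v}), 2 ^ ℵ₀ < κ →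
      IsKappaSaturated groupPredLanguage (M := WithPred N Q) κ →
      IsStronglyKappaHomogeneous groupPredLanguage (M := WithPred N Q) κ →
      ∃ H : Subgroup (WithPred N Q),
        (H : Set (WithPred N Q)) =
            ⋂ (n : ℕ) (_ : 1 ≤ n),
              interpretation groupPredLanguage (M := WithPred G (arcPreimage g t))
                (WithPred N Q) (arcPreimage g (t / n)) ∧
          IsTypeDefinable groupPredLanguage ∅ (H : Set (WithPred N Q)) ∧
          HasBoundedIndex κ H ∧
          ∀ A : Set (WithPred N Q), #A < κ →
            H ⊓ connectedComponentOver groupPredLanguage A <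
                connectedComponentOver groupPredLanguage A ∧
              typeConnectedComponentOver groupPredLanguage κ A <
                connectedComponentOver groupPredLanguage A := by
  have hint (n : ℕ) (hn : 1 ≤ n) : arcPreimage g (t / n) =
      powersIn (G := WithPred G (arcPreimage g t)) (arcPreimage g t) n :=
    arcPreimage_div g ht0 ht hn
  refine ⟨fun n hn => ?_, fun N _ Q j κ hκ hsat _ => ?_⟩
  · exact definable₁_of_eq_powersIn (hint n hn) ∅
  have htype := isTypeDefinable_infinitesimalSubgroup hg j ht0 ht
  have hindex : HasBoundedIndex κ (infinitesimalSubgroup hg j ht0 ht) :=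
    (mk_quotient_infinitesimalSubgroup_le hg j ht0 ht).trans_lt hκ
  refine ⟨infinitesimalSubgroup hg j ht0 ht, ?_, htype, hindex, fun A hA => ?_⟩
  · rw [coe_infinitesimalSubgroup]
    exact Set.iInter₂_congr fun n hn => (interpretation_of_eq_powersIn j (hint n hn)).symm
  have hQ : A.Definable₁ groupPredLanguage (Q : Set (WithPred N Q)) :=
    WithPred.formulaDefines_pred.definable₁ A
  -- This one point witnesses both strict inclusions, since the type-connected component lies in the
  -- infinitesimal subgroup.
  obtain ⟨x, hx, hxQ⟩ := exists_mem_connectedComponentOver_notMem hsat hA hQ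
    (not_subset_of_finiteIndex hg j ht)
  have hxH : x ∉ infinitesimalSubgroup hg j ht0 ht :=
    fun h => hxQ (infinitesimalSubgroup_subset hg j ht0 ht h)
  have hle : typeConnectedComponentOver groupPredLanguage κ A ≤ infinitesimalSubgroup hg j ht0 ht :=
    sInf_le ⟨htype.mono (Set.empty_subset A), hindex⟩
  refine ⟨lt_of_le_of_ne inf_le_right fun h => hxH (h.ge hx).1,
    lt_of_le_of_ne (typeConnectedComponentOver_le_connectedComponentOver
      ((Cardinal.cantor ℵ₀).trans hκ).le A) fun h => hxH (hle (h.ge hx))⟩
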